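/- Fix a real number $h\ge 0$ and integers $0\le l<n$. A secret $X$ is uniformly distributed on $\{1,\dots,2^{\lceil h\rceil}\}$ and, independently of $X$, a set of exactly $l$ leakers is chosen uniformly among the $l$-element subsets of a set of $n$ players; each leaker knows $X$. A collaborating cryptogenography protocol $\pi$ specifies, for every possible current transcript (the finite sequence of messages broadcast so far), whether the communication stops, and otherwise which player sends the next message, a discrete distribution $p_?$ and discrete distributions $p_x$ (one for each value $x$ of the secret): the sender draws the message from $p_?$ if she is not a leaker, and from $p_x$ if she is a leaker and $X=x$. The protocol must stop after at most some number $\mathrm{length}(\pi)$ of messages. After the communication Frank, who sees the transcript, guesses a value of $X$; then Eve, who sees the transcript and Frank's guess, guesses one player. The communicating players and Frank win if Frank's guess equals $X$ and Eve's guess is not a leaker; otherwise Eve wins. Let $\mathrm{Succ}(h,l,n,\pi)$ be the probability that the communicating players win when Frank and Eve each guess so as to maximise their own probability of winning, and let \[\mathrm{Succ}(h,l,n)=\sup_\pi \mathrm{Succ}(h,l,n,\pi),\qquad \mathrm{Succ}(h,l)=\lim_{n\to\infty}\mathrm{Succ}(h,l,n).\] Let $\log$ denote the logarithm to base $2$ and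 $e$ the base of the natural logarithm. Then the limit defining $\mathrm{Succ}(h,l)$ exists for all real $h\ge 0$ and integers $l\ge 0$, it is non-increasing in $h$, and for every $p\in(0,1)$, \[\liminf_{l\to\infty}\mathrm{Succ}\left(\left\lceil\left(\frac{-\log p}{1-p}-\log e\right)l\right\rceil,\,l\right)\ge p.\] In particular, if $h=h(l)\ge 0$ is a function of $l$ with $h(l)=o(l)$ as $l\to\infty$, then $\mathrm{Succ}(h(l),l)\to 1$. -/

import Mathlib

open Filter Topology

noncomputable section

namespace Cryptogenography

/-- A collaborating cryptogenography protocol for `n` players and a secret in `X`. Messages are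
coded by natural numbers, so every discrete message distribution is allowed. A transcript is the
list of the messages sent so far, oldest first. -/
structure Protocol (n : ℕ) (X : Type) where
  /-- Given the current transcript: stop (`none`), or player `i` sends the next message
  (`some i`). -/
  next : List ℕ → Option (Fin n)
  /-- The distribution of the next message if its sender is not leaking. -/
  innocent : List ℕ → PMF ℕ
  /-- The distribution of the next message if its sender is leaking and the secret is `x`. -/
  leaking : List ℕ → X → PMF ℕ
  /-- A bound on the number of messages. -/
  length : ℕ
  /-- The protocol has stopped once `length` messages have been sent. -/
  next_eq_none : ∀ t : List ℕ, length ≤ t.length → next t = none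

namespace Protocol

variable {n : ℕ} {X : Type}

open Classical in
/-- The distribution of the next message after the transcript `t` when the sender is `i`,
the secret is `x` and the set of leakers is `S`. -/
def message (π : Protocol n X) (x : X) (S : Finset (Fin n)) (t : List ℕ) (i : Fin n) : PMF ℕ :=
  if i ∈ S then π.leaking t x else π.innocent t

/-- The distribution of the transcript after at most `k` further messages, starting from the
transcript `t`, when the secret is `x` and the set of leakers is `S`. -/
def run (π : Protocol n X) (x : X) (S : Finset (Fin n)) : ℕ → List ℕ → PMF (List ℕ)
  | 0, t => PMF.pure t
  | k + 1, t =>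
    match π.next t with
    | none => PMF.pure t
    | some i => (π.message x S t i).bind fun m => run π x S k (t ++ [m])

/-- The distribution of the complete transcript given the secret `x` and the set `S` of
leakers. -/
def transcript (π : Protocol n X) (x : X) (S : Finset (Fin n)) : PMF (List ℕ) :=
  π.run x S π.length []

end Protocol

/-- The set of possible secrets consisting of `⌈h⌉` bits. -/
abbrev Secret (h : ℝ) : Type := Fin (2 ^ ⌈h⌉₊)

/-- The probability that the communicating players win when Frank and Eve use the strategies
`F` and `E`: Frank's guess `F T` depends on the complete transcript `T`, Eve's guess `E T (F T)`
depends on the transcript and on Frank's guess, and the players win if Frank's guess is the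
secret and Eve's guess is not a leaker. The secret is uniform, the set of leakers is uniform
among the sets of `l` players, and the two are independent. -/
def winProb (h : ℝ) (l n : ℕ) (π : Protocol n (Secret h)) (F : List ℕ → Secret h)
    (E : List ℕ → Secret h → Fin n) : ℝ :=
  (∑ x : Secret h, ∑ S ∈ Finset.powersetCard l (Finset.univ : Finset (Fin n)),
      ((π.transcript x S).toOuterMeasure {t | F t = x ∧ E t (F t) ∉ S}).toReal) /
    ((2 : ℝ) ^ ⌈h⌉₊ * (n.choose l : ℝ))

/-- `Succ(h, l, n, π)`: the winning probability when Frank maximises the probability that the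
players win, and Eve, who guesses after Frank, minimises it. -/
def succProtocol (h : ℝ) (l n : ℕ) (π : Protocol n (Secret h)) : ℝ :=
  ⨆ F : List ℕ → Secret h, ⨅ E : List ℕ → Secret h → Fin n, winProb h l n π F E

/-- `Succ(h, l, n)`. -/
def succN (h : ℝ) (l n : ℕ) : ℝ :=
  ⨆ π : Protocol n (Secret h), succProtocol h l n π

/-- `Succ(h, l)`. -/
def succLim (h : ℝ) (l : ℕ) : ℝ :=
  limUnder atTop fun n : ℕ => succN h l n

end Cryptogenography

end

noncomputable section

namespace Cryptogenography

/-! For the lower bound, fix `q < p` and let each of `n = l * D` players send a random set of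
secrets, containing each secret with probability `β`; leakers always include the true one. Frank
accepts a secret `x` if it is the only one named by at least `τ = l / (1 - q)` players. Given `x`
and the transcript, the leakers are uniform among the `l`-subsets of the players naming `x`, so Eve
finds one with probability at most `l / τ = 1 - q` (`mul_sum_setsLikelihood_le`).

It remains to see that the true secret passes the threshold and no other does. Put `ρ = q / (1 -
q)`, so that `τ = l + ρ * l`. Taking `n * β` slightly above `ρ * l`, the true secret passes with
probability tending to 1, while by Chernoff's bound with tilt `-log q` a false one passes with
probability about `exp (-(-log q / (1 - q) - 1) * l)`. Since `-log q / (1 - q)` is strictly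
decreasing in `q`, this beats the `2 ^ ⌈h⌉₊` secrets allowed by `p` (`exists_le_succLim`). Then `q`
tends to `p`.

The limit in `n` exists because `succN` is bounded and, for `n > l`, non-decreasing in `n`: an
innocent player can eliminate herself by announcing her innocence (`Achieves.announce`). It is
non-increasing in `h` because surplus bits of the secret can be fixed to their best value
(`Achieves.fix`). Both arguments, and the protocol above, are carried out with unnormalised weights,
in the calculus of `Achieves`. -/

/-- The probability of the event `s`, as a real number. -/
def prob {α : Type} (p : PMF α) (s : Set α) : ℝ := (p.toOuterMeasure s).toReal

/-! ### Real-valued probabilities of events under a `PMF`. -/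

section Prob

variable {α β : Type}

lemma prob_nonneg (p : PMF α) (s : Set α) : 0 ≤ prob p s := ENNReal.toReal_nonneg

lemma toOuterMeasure_le_one (p : PMF α) (s : Set α) : p.toOuterMeasure s ≤ 1 := by
  rw [PMF.toOuterMeasure_apply, ← p.tsum_coe]
  exact ENNReal.tsum_le_tsum fun a => Set.indicator_le_self _ _ a

lemma toOuterMeasure_ne_top (p : PMF α) (s : Set α) : p.toOuterMeasure s ≠ ⊤ :=
  ne_top_of_le_ne_top ENNReal.one_ne_top (toOuterMeasure_le_one p s)

lemma prob_le_one (p : PMF α) (s : Set α) : prob p s ≤ 1 :=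
  ENNReal.toReal_le_of_le_ofReal zero_le_one (by simpa using toOuterMeasure_le_one p s)

lemma prob_mono (p : PMF α) {s t : Set α} (h : s ⊆ t) : prob p s ≤ prob p t :=
  ENNReal.toReal_mono (toOuterMeasure_ne_top p t) (p.toOuterMeasure.mono h)

lemma prob_map (f : α → β) (p : PMF α) (s : Set β) : prob (p.map f) s = prob p (f ⁻¹' s) := by
  rw [prob, prob, PMF.toOuterMeasure_map_apply]

open Classical in
lemma prob_pure (a : α) (s : Set α) : prob (PMF.pure a) s = if a ∈ s then 1 else 0 := by
  rw [prob, PMF.toOuterMeasure_pure_apply]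
  split_ifs <;> simp

lemma prob_bind [Fintype α] (p : PMF α) (f : α → PMF β) (s : Set β) :
    prob (p.bind f) s = ∑ a, (p a).toReal * prob (f a) s := by
  rw [prob, PMF.toOuterMeasure_bind_apply, tsum_fintype, ENNReal.toReal_sum]
  · simp [prob, ENNReal.toReal_mul]
  · exact fun a _ => ENNReal.mul_ne_top (p.apply_ne_top a) (toOuterMeasure_ne_top _ _)

/-- The distribution on a finite type with given real weights. -/
def finitePMF [Fintype α] (f : α → ℝ) (h0 : ∀ a, 0 ≤ f a) (h1 : ∑ a, f a = 1) : PMF α :=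
  PMF.ofFintype (fun a => ENNReal.ofReal (f a)) (by
    rw [← ENNReal.ofReal_sum_of_nonneg fun a _ => h0 a, h1, ENNReal.ofReal_one])

lemma toReal_finitePMF [Fintype α] (f : α → ℝ) (h0 : ∀ a, 0 ≤ f a) (h1 : ∑ a, f a = 1) (a : α) :
    (finitePMF f h0 h1 a).toReal = f a := by
  simp [finitePMF, PMF.ofFintype_apply, h0 a]

end Prob

/-! ### Composing and relabelling protocols. -/

namespace Protocol

variable {n : ℕ} {X A : Type}

/-- Past its length bound a protocol has stopped, so surplus steps change nothing. This lets
continuations of different lengths run for their common maximum. -/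
lemma run_add (π : Protocol n X) (x : X) (S : Finset (Fin n)) (j k : ℕ) (t : List ℕ)
    (h : π.length ≤ k + t.length) : π.run x S (k + j) t = π.run x S k t := by
  induction k generalizing t with
  | zero =>
    have hn := π.next_eq_none t (by omega)
    cases j with
    | zero => rfl
    | succ j => simp [run, hn]
  | succ k ih =>
    rw [show k + 1 + j = k + j + 1 by ring]
    simp only [run]
    cases hn : π.next t with
    | none => rfl
    | some i =>
      simp only
      congr 1
      funext m
      exact ih _ (by simp; omega)

/-- Player `i` sends one message, coded by `enc`, and the play continues as prescribed by
the protocol attached to that message. -/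
def prepend [Fintype A] (i : Fin n) (inn : PMF A) (lk : X → PMF A) (enc : A → ℕ) (dec : ℕ → A)
    (π : A → Protocol n X) : Protocol n X where
  next
    | [] => some i
    | m :: t => (π (dec m)).next t
  innocent
    | [] => inn.map enc
    | m :: t => (π (dec m)).innocent t
  leaking
    | [], x => (lk x).map enc
    | m :: t, x => (π (dec m)).leaking t x
  length := Finset.univ.sup (fun a => (π a).length) + 1
  next_eq_none
    | [], h => by simp at h
    | m :: t, h => (π (dec m)).next_eq_none t <|
        (Finset.le_sup (f := fun a => (π a).length) (Finset.mem_univ (dec m))).trans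
          (by simpa using h)

lemma run_prepend [Fintype A] (i : Fin n) (inn : PMF A) (lk : X → PMF A) (enc : A → ℕ)
    (dec : ℕ → A) (π : A → Protocol n X) (x : X) (S : Finset (Fin n)) (m k : ℕ) (t : List ℕ) :
    (prepend i inn lk enc dec π).run x S k (m :: t) =
      ((π (dec m)).run x S k t).map (List.cons m) := by
  induction k generalizing t with
  | zero => simp [run, PMF.pure_map]
  | succ k ih =>
    have hn : (prepend i inn lk enc dec π).next (m :: t) = (π (dec m)).next t := rfl
    simp only [run, hn]
    cases (π (dec m)).next t with
    | none => simp [PMF.pure_map]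
    | some j =>
      simp only [PMF.map_bind]
      congr 1
      funext m'
      exact ih _

open Classical in
lemma prob_transcript_prepend [Fintype A] (i : Fin n) (inn : PMF A) (lk : X → PMF A) (enc : A → ℕ)
    (dec : ℕ → A) (hdec : ∀ a, dec (enc a) = a) (π : A → Protocol n X) (x : X)
    (S : Finset (Fin n)) (s : Set (List ℕ)) :
    prob ((prepend i inn lk enc dec π).transcript x S) s =
      ∑ a, (if i ∈ S then lk x a else inn a).toReal *
        prob ((π a).transcript x S) (List.cons (enc a) ⁻¹' s) := by
  have hm : (prepend i inn lk enc dec π).message x S [] i =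
      (if i ∈ S then lk x else inn).map enc := by
    simp only [message, prepend]
    split_ifs <;> rfl
  have ht : (prepend i inn lk enc dec π).transcript x S =
      (if i ∈ S then lk x else inn).bind fun a =>
        ((π a).transcript x S).map (List.cons (enc a)) := by
    rw [transcript]
    change ((prepend i inn lk enc dec π).message x S [] i).bind _ = _
    rw [hm, PMF.bind_map]
    congr 1
    funext a
    simp only [Function.comp, List.nil_append]
    rw [run_prepend, hdec, transcript]
    have hle : (π a).length ≤ Finset.univ.sup (fun a => (π a).length) :=
      Finset.le_sup (f := fun a => (π a).length) (Finset.mem_univ a)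
    obtain ⟨j, hj⟩ := Nat.exists_eq_add_of_le hle
    rw [hj, run_add _ _ _ _ _ _ (by simp)]
  rw [ht, prob_bind]
  refine Finset.sum_congr rfl fun a _ => ?_
  rw [prob_map]
  split_ifs <;> rfl

/-- The protocol without communication. -/
def silent (n : ℕ) (X : Type) : Protocol n X where
  next _ := none
  innocent _ := PMF.pure 0
  leaking _ _ := PMF.pure 0
  length := 0
  next_eq_none _ _ := rfl

/-- The protocol played by the players in the range of `σ`, for the secret `τ x`. -/
def relabel {m : ℕ} {Y : Type} (π : Protocol n X) (σ : Fin n ↪ Fin m) (τ : Y → X) :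
    Protocol m Y where
  next t := (π.next t).map σ
  innocent := π.innocent
  leaking t y := π.leaking t (τ y)
  length := π.length
  next_eq_none t h := by simp [π.next_eq_none t h]

lemma transcript_relabel {m : ℕ} {Y : Type} (π : Protocol n X) (σ : Fin n ↪ Fin m) (τ : Y → X)
    (y : Y) (S : Finset (Fin n)) :
    (π.relabel σ τ).transcript y (S.map σ) = π.transcript (τ y) S := by
  have h : ∀ k t, (π.relabel σ τ).run y (S.map σ) k t = π.run (τ y) S k t := by
    intro k
    induction k with
    | zero => intro t; rfl
    | succ k ih =>
      intro t
      have hn : (π.relabel σ τ).next t = (π.next t).map σ := rfl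
      simp only [run, hn]
      cases π.next t with
      | none => rfl
      | some i =>
        have hm : (π.relabel σ τ).message y (S.map σ) t (σ i) = π.message (τ y) S t i := by
          simp [message, relabel]
        simp only [Option.map_some, hm, ih]
  exact h _ _

end Protocol

/-! ### Unnormalised winning weights. -/

/-- The weight with which the players win, when the pair of the secret `x` and the set `S` of
leakers has weight `w x S`. -/
def winWeight {n : ℕ} {X : Type} [Fintype X] (w : X → Finset (Fin n) → ℝ) (π : Protocol n X)
    (F : List ℕ → X) (E : List ℕ → X → Fin n) : ℝ :=
  ∑ x, ∑ S, w x S * prob (π.transcript x S) {t | F t = x ∧ E t (F t) ∉ S}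

/-- For some protocol and some strategy of Frank, the players win with weight at least `v`
against every strategy of Eve. -/
def Achieves {n : ℕ} {X : Type} [Fintype X] (w : X → Finset (Fin n) → ℝ) (v : ℝ) : Prop :=
  ∃ (π : Protocol n X) (F : List ℕ → X), ∀ E : List ℕ → X → Fin n, v ≤ winWeight w π F E

section Achieves

variable {n : ℕ} {X A : Type} [Fintype X]

open Classical in
lemma achieves_silent (w : X → Finset (Fin n) → ℝ) (v : ℝ) (x : X)
    (h : ∀ i, v ≤ ∑ S, if i ∉ S then w x S else 0) : Achieves w v := by
  refine ⟨Protocol.silent n X, fun _ => x, fun E => (h (E [] x)).trans (le_of_eq ?_)⟩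
  rw [winWeight, Finset.sum_eq_single x]
  · refine Finset.sum_congr rfl fun S _ => ?_
    change _ = w x S * prob (PMF.pure []) _
    rw [prob_pure]
    simp
  · intro y _ hy
    refine Finset.sum_eq_zero fun S _ => ?_
    change w y S * prob (PMF.pure []) _ = 0
    rw [prob_pure]
    simp [hy.symm]
  · simp

lemma achieves_zero [Nonempty X] (w : X → Finset (Fin n) → ℝ) (hw : ∀ x S, 0 ≤ w x S) :
    Achieves w 0 :=
  ⟨Protocol.silent n X, fun _ => Classical.arbitrary X, fun _ => Finset.sum_nonneg fun x _ =>
    Finset.sum_nonneg fun S _ => mul_nonneg (hw x S) (prob_nonneg _ _)⟩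

lemma Achieves.smul {w : X → Finset (Fin n) → ℝ} {v c : ℝ} (h : Achieves w v) (hc : 0 ≤ c) :
    Achieves (fun x S => c * w x S) (c * v) := by
  obtain ⟨π, F, h⟩ := h
  refine ⟨π, F, fun E => (mul_le_mul_of_nonneg_left (h E) hc).trans (le_of_eq ?_)⟩
  simp only [winWeight, Finset.mul_sum, mul_assoc]

open Classical in
-- The continuations chosen for the various messages glue to one protocol. A message only multiplies
-- the weights by its likelihood; no conditioning is needed, and messages of probability zero are
-- harmless.
lemma achieves_message [Fintype A] [Nonempty A] (w : X → Finset (Fin n) → ℝ) (i : Fin n)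
    (inn : A → ℝ) (lk : X → A → ℝ) (hi : ∀ a, 0 ≤ inn a) (hi1 : ∑ a, inn a = 1)
    (hl : ∀ x a, 0 ≤ lk x a) (hl1 : ∀ x, ∑ a, lk x a = 1) (v : A → ℝ)
    (h : ∀ a, Achieves (fun x S => (if i ∈ S then lk x a else inn a) * w x S) (v a)) :
    Achieves w (∑ a, v a) := by
  choose π F h using h
  let enc : A → ℕ := fun a => Fintype.equivFin A a
  have henc : Function.Injective enc := Fin.val_injective.comp (Fintype.equivFin A).injective
  let dec := Function.invFun enc
  have hdec : ∀ a, dec (enc a) = a := Function.leftInverse_invFun henc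
  refine ⟨Protocol.prepend i (finitePMF inn hi hi1) (fun x => finitePMF (lk x) (hl x) (hl1 x))
    enc dec π, fun t => F (dec t.headI) t.tail, fun E => ?_⟩
  refine (Finset.sum_le_sum fun a _ => h a (fun t x => E (enc a :: t) x)).trans (le_of_eq ?_)
  simp only [winWeight, Protocol.prob_transcript_prepend _ _ _ _ _ hdec]
  rw [Finset.sum_comm]
  refine Finset.sum_congr rfl fun x _ => ?_
  rw [Finset.sum_comm]
  refine Finset.sum_congr rfl fun S _ => ?_
  rw [Finset.mul_sum]
  refine Finset.sum_congr rfl fun a _ => ?_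
  simp only [Set.preimage_ofPred_eq, List.headI_cons, List.tail_cons, hdec]
  split_ifs <;> rw [toReal_finitePMF] <;> ring

open Classical in
lemma achieves_messages [Fintype A] [Nonempty A] (inn : A → ℝ) (lk : X → A → ℝ)
    (hi : ∀ a, 0 ≤ inn a) (hi1 : ∑ a, inn a = 1) (hl : ∀ x a, 0 ≤ lk x a)
    (hl1 : ∀ x, ∑ a, lk x a = 1) (k : ℕ) (σ : Fin k → Fin n) (w : X → Finset (Fin n) → ℝ)
    (v : (Fin k → A) → ℝ)
    (h : ∀ T, Achieves
      (fun x S => (∏ j, if σ j ∈ S then lk x (T j) else inn (T j)) * w x S) (v T)) :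
    Achieves w (∑ T, v T) := by
  induction k generalizing w with
  | zero => simpa using h default
  | succ k ih =>
    rw [← (Fin.consEquiv fun _ => A).sum_comp, Fintype.sum_prod_type]
    refine achieves_message w (σ 0) inn lk hi hi1 hl hl1 _ fun a => ?_
    refine ih (fun j => σ j.succ) _ _ fun T => ?_
    change Achieves _ (v (Fin.cons a T))
    convert h (Fin.cons a T) using 3
    rw [Fin.prod_univ_succ]
    simp only [Fin.cons_zero, Fin.cons_succ]
    ring

open Classical in
/-- Every player sends one message. -/
lemma achieves_round [Fintype A] [Nonempty A] (inn : A → ℝ) (lk : X → A → ℝ)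
    (hi : ∀ a, 0 ≤ inn a) (hi1 : ∑ a, inn a = 1) (hl : ∀ x a, 0 ≤ lk x a)
    (hl1 : ∀ x, ∑ a, lk x a = 1) (w : X → Finset (Fin n) → ℝ) (v : (Fin n → A) → ℝ)
    (h : ∀ T, Achieves
      (fun x S => (∏ j, if j ∈ S then lk x (T j) else inn (T j)) * w x S) (v T)) :
    Achieves w (∑ T, v T) :=
  achieves_messages inn lk hi hi1 hl hl1 n id w v h

lemma Achieves.relabel {m : ℕ} (hn : 0 < n) {w : X → Finset (Fin n) → ℝ} {v : ℝ}
    (h : Achieves w v) (σ : Fin n ↪ Fin m) (w' : X → Finset (Fin m) → ℝ)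
    (hw : ∀ x S, w' x (S.map σ) = w x S) (hw' : ∀ x S, 0 ≤ w' x S) : Achieves w' v := by
  classical
  obtain ⟨π, F, h⟩ := h
  have : Nonempty (Fin n) := ⟨⟨0, hn⟩⟩
  -- A guess outside the range of `σ` is pulled back to an arbitrary player, which can only help
  -- Eve. Leaker sets not contained in the range are discarded from the sum.
  refine ⟨π.relabel σ id, F, fun E => (h fun t x => Function.invFun σ (E t x)).trans ?_⟩
  refine Finset.sum_le_sum fun x _ => ?_
  have hinj : Function.Injective fun S : Finset (Fin n) => S.map σ := Finset.map_injective σ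
  calc _ ≤ ∑ S : Finset (Fin n), w' x (S.map σ) *
        prob ((π.relabel σ id).transcript x (S.map σ)) {t | F t = x ∧ E t (F t) ∉ S.map σ} := by
        refine Finset.sum_le_sum fun S _ => ?_
        rw [hw, Protocol.transcript_relabel]
        refine mul_le_mul_of_nonneg_left (prob_mono _ ?_) (by rw [← hw]; exact hw' _ _)
        rintro t ⟨h1, h2⟩
        refine ⟨h1, fun h3 => h2 ?_⟩
        obtain ⟨i, hi, he⟩ := Finset.mem_map.1 h3
        change Function.invFun σ (E t (F t)) ∈ S
        rw [← he, Function.leftInverse_invFun σ.injective i]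
        exact hi
    _ = ∑ S ∈ Finset.univ.map ⟨_, hinj⟩, w' x S *
        prob ((π.relabel σ id).transcript x S) {t | F t = x ∧ E t (F t) ∉ S} := by
        rw [Finset.sum_map]; rfl
    _ ≤ _ := Finset.sum_le_sum_of_subset_of_nonneg (Finset.subset_univ _) fun S _ _ =>
        mul_nonneg (hw' x S) (prob_nonneg _ _)

/-- A public part of the secret may be fixed to its best value. -/
lemma Achieves.fix {X' Y : Type} [Fintype X'] [Fintype Y] [Nonempty Y] (e : X' ≃ Y × X)
    {u : Finset (Fin n) → ℝ} (hu : ∀ S, 0 ≤ u S) {v : ℝ}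
    (h : Achieves (fun (_ : X') S => u S) (Fintype.card Y * v)) :
    Achieves (fun (_ : X) S => u S) v := by
  obtain ⟨π, F, h⟩ := h
  let part (y : Y) (E : List ℕ → X' → Fin n) : ℝ := ∑ x : X, ∑ S, u S *
    prob (π.transcript (e.symm (y, x)) S) {t | F t = e.symm (y, x) ∧ E t (F t) ∉ S}
  have hsum : ∀ E, winWeight (fun _ S => u S) π F E = ∑ y, part y E := fun E => by
    rw [winWeight, ← e.symm.sum_comp, Fintype.sum_prod_type]
  have hy : ∃ y, ∀ E, v ≤ part y E := by
    by_contra! hc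
    choose E hE using hc
    -- Eve combines her replies `E y` by reading `y` off Frank's guess. Only correct guesses count,
    -- so there `y` is the true public part.
    have h1 := h fun t g => E (e g).1 t g
    rw [hsum] at h1
    have h2 : ∀ y, part y (fun t g => E (e g).1 t g) = part y (E y) := fun y => by
      refine Finset.sum_congr rfl fun x _ => Finset.sum_congr rfl fun S _ => ?_
      congr 2
      ext t
      simp only [Set.mem_ofPred_eq, and_congr_right_iff]
      intro ht
      rw [ht, Equiv.apply_symm_apply]
    simp only [h2] at h1
    have h3 : ∑ y, part y (E y) < ∑ _y : Y, v :=
      Finset.sum_lt_sum_of_nonempty Finset.univ_nonempty fun y _ => hE y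
    simp only [Finset.sum_const, Finset.card_univ, nsmul_eq_mul] at h3
    linarith
  obtain ⟨y, hy⟩ := hy
  refine ⟨π.relabel (Function.Embedding.refl _) fun x => e.symm (y, x), fun t => (e (F t)).2,
    fun E => (hy fun t g => E t (e g).2).trans ?_⟩
  refine Finset.sum_le_sum fun x _ => Finset.sum_le_sum fun S _ => ?_
  have := Protocol.transcript_relabel π (Function.Embedding.refl _)
    (fun x => e.symm (y, x)) x S
  rw [Finset.map_refl] at this
  rw [this]
  refine mul_le_mul_of_nonneg_left (prob_mono _ ?_) (hu S)
  rintro t ⟨h1, h2⟩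
  refine ⟨by simp [h1], h2⟩

end Achieves

/-! ### From weights to the success probabilities. -/

/-- The indicator function of the sets of `l` leakers. -/
def leakerWeight {n : ℕ} (l : ℕ) (S : Finset (Fin n)) : ℝ := if S.card = l then 1 else 0

lemma leakerWeight_nonneg {n : ℕ} (l : ℕ) (S : Finset (Fin n)) : 0 ≤ leakerWeight l S := by
  unfold leakerWeight; split_ifs <;> norm_num

section Success

variable {h : ℝ} {l n : ℕ}

lemma winProb_eq (π : Protocol n (Secret h)) (F : List ℕ → Secret h)
    (E : List ℕ → Secret h → Fin n) :
    winProb h l n π F E =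
      winWeight (fun _ => leakerWeight l) π F E / ((2 : ℝ) ^ ⌈h⌉₊ * (n.choose l : ℝ)) := by
  rw [winProb, winWeight]
  congr 1
  refine Finset.sum_congr rfl fun x _ => ?_
  simp only [leakerWeight, ite_mul, one_mul, zero_mul]
  rw [← Finset.sum_filter]
  refine Finset.sum_congr ?_ fun _ _ => rfl
  ext S
  simp

lemma winProb_nonneg (π : Protocol n (Secret h)) (F : List ℕ → Secret h)
    (E : List ℕ → Secret h → Fin n) : 0 ≤ winProb h l n π F E :=
  div_nonneg (Finset.sum_nonneg fun _ _ => Finset.sum_nonneg fun _ _ => prob_nonneg _ _)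
    (by positivity)

lemma winProb_le_one (π : Protocol n (Secret h)) (F : List ℕ → Secret h)
    (E : List ℕ → Secret h → Fin n) : winProb h l n π F E ≤ 1 := by
  refine div_le_one_of_le₀ ?_ (by positivity)
  refine (Finset.sum_le_sum fun x _ => Finset.sum_le_sum fun S _ => prob_le_one _ _).trans ?_
  simp

lemma bddBelow_winProb (π : Protocol n (Secret h)) (F : List ℕ → Secret h) :
    BddBelow (Set.range fun E => winProb h l n π F E) :=
  ⟨0, by rintro _ ⟨E, rfl⟩; exact winProb_nonneg _ _ _⟩

lemma iInf_winProb_le_one (π : Protocol n (Secret h)) (F : List ℕ → Secret h) :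
    ⨅ E, winProb h l n π F E ≤ 1 := by
  rcases isEmpty_or_nonempty (List ℕ → Secret h → Fin n) with hE | ⟨⟨E⟩⟩
  -- With no players Eve has no strategy, and the real infimum over an empty type is 0.
  · rw [Real.iInf_of_isEmpty]; exact zero_le_one
  · exact (ciInf_le (bddBelow_winProb π F) E).trans (winProb_le_one _ _ _)

lemma bddAbove_iInf_winProb (π : Protocol n (Secret h)) :
    BddAbove (Set.range fun F => ⨅ E, winProb h l n π F E) :=
  ⟨1, by rintro _ ⟨F, rfl⟩; exact iInf_winProb_le_one _ _⟩

lemma succProtocol_le_one (π : Protocol n (Secret h)) : succProtocol h l n π ≤ 1 :=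
  Real.iSup_le (fun F => iInf_winProb_le_one π F) zero_le_one

lemma bddAbove_succProtocol : BddAbove (Set.range (succProtocol h l n)) :=
  ⟨1, by rintro _ ⟨π, rfl⟩; exact succProtocol_le_one π⟩

lemma succN_le_one : succN h l n ≤ 1 := Real.iSup_le succProtocol_le_one zero_le_one

lemma succN_nonneg : 0 ≤ succN h l n :=
  Real.iSup_nonneg fun _ => Real.iSup_nonneg fun _ => Real.iInf_nonneg fun _ =>
    winProb_nonneg _ _ _

lemma uniform_normalizer_pos (hl : l ≤ n) : 0 < (2 : ℝ) ^ ⌈h⌉₊ * (n.choose l : ℝ) := by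
  have := Nat.choose_pos hl
  positivity

lemma Achieves.le_succN (hn : 0 < n) (hl : l ≤ n) {v : ℝ}
    (hv : Achieves (n := n) (fun _ : Secret h => leakerWeight l)
      (v * ((2 : ℝ) ^ ⌈h⌉₊ * (n.choose l : ℝ)))) :
    v ≤ succN h l n := by
  obtain ⟨π, F, hv⟩ := hv
  have : Nonempty (List ℕ → Secret h → Fin n) := ⟨fun _ _ => ⟨0, hn⟩⟩
  have h1 : v ≤ ⨅ E, winProb h l n π F E := le_ciInf fun E => by
    rw [winProb_eq, le_div_iff₀ (uniform_normalizer_pos hl)]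
    exact hv E
  exact (h1.trans (le_ciSup (bddAbove_iInf_winProb π) F)).trans
    (le_ciSup bddAbove_succProtocol π)

lemma achieves_of_lt_succN (hl : l ≤ n) {v : ℝ} (hv : v < succN h l n) :
    Achieves (n := n) (fun _ : Secret h => leakerWeight l)
      (v * ((2 : ℝ) ^ ⌈h⌉₊ * (n.choose l : ℝ))) := by
  have : Nonempty (Protocol n (Secret h)) := ⟨Protocol.silent _ _⟩
  obtain ⟨π, hπ⟩ := exists_lt_of_lt_ciSup hv
  obtain ⟨F, hF⟩ := exists_lt_of_lt_ciSup hπ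
  refine ⟨π, F, fun E => ?_⟩
  rw [← le_div_iff₀ (uniform_normalizer_pos hl), ← winProb_eq]
  exact hF.le.trans (ciInf_le (bddBelow_winProb π F) E)

end Success

/-! ### Monotonicity in the number of players and in the secret length. -/

section Monotone

lemma prod_ite_mem_one {n l : ℕ} (S : Finset (Fin n)) (hS : S.card = l) (a : ℝ) :
    ∏ j, (if j ∈ S then 1 else a) = a ^ (n - l) := by
  rw [Finset.prod_ite, Finset.prod_const_one, one_mul, Finset.prod_const]
  congr 1
  rw [← Finset.compl_filter, Finset.filter_univ_mem, Finset.card_compl, hS, Fintype.card_fin]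

/-- The effect of a round in which every innocent player announces her innocence with
probability `q`. -/
lemma Achieves.announce {X : Type} [Fintype X] [Nonempty X] {l n : ℕ} (hn : 0 < n)
    {a b q : ℝ} (hq0 : 0 ≤ q) (hq1 : q ≤ 1)
    (ha : Achieves (n := n + 1) (fun _ : X => leakerWeight l) a)
    (hb : Achieves (n := n) (fun _ : X => leakerWeight l) b) :
    Achieves (n := n + 1) (fun _ : X => leakerWeight l)
      ((1 - q) ^ (n + 1 - l) * a + (n + 1) * (q * (1 - q) ^ (n - l) * b)) := by
  classical
  -- `T0`: nobody announces, and the `n + 1` players go on. `T1 j`: only `j` announces, and the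
  -- others play among themselves. After any other transcript the value 0 suffices.
  let T0 : Fin (n + 1) → Bool := fun _ => false
  let T1 : Fin (n + 1) → Fin (n + 1) → Bool := fun j => Function.update T0 j true
  have h01 : ∀ j, T1 j ≠ T0 := fun j hj => by simpa [T1, T0] using congrFun hj j
  have h11 : ∀ i j, T1 i = T1 j → i = j := fun i j hij => by
    by_contra hne
    have := congrFun hij i
    simp [T1, T0, hne] at this
  let inn : Bool → ℝ := fun m => if m then q else 1 - q
  let lk : X → Bool → ℝ := fun _ m => if m then 0 else 1
  have hw : ∀ (T : Fin (n + 1) → Bool) (x : X) (S : Finset (Fin (n + 1))),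
      0 ≤ (∏ j, if j ∈ S then lk x (T j) else inn (T j)) * leakerWeight l S := fun T x S => by
    refine mul_nonneg (Finset.prod_nonneg fun j _ => ?_) (leakerWeight_nonneg l S)
    simp only [lk, inn]
    split_ifs <;> linarith
  have key := achieves_round (n := n + 1) inn lk
    (fun m => by simp only [inn]; split_ifs <;> linarith) (by simp [inn])
    (fun x m => by simp only [lk]; split_ifs <;> norm_num) (fun x => by simp [lk])
    (fun _ => leakerWeight l)
    (fun T => (if T = T0 then (1 - q) ^ (n + 1 - l) * a else 0) +
      ∑ j, if T = T1 j then q * (1 - q) ^ (n - l) * b else 0) ?_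
  · convert key using 1
    rw [Finset.sum_add_distrib, Finset.sum_comm]
    simp
  intro T
  by_cases hT0 : T = T0
  · subst hT0
    simp only [(h01 _).symm, if_true, if_false, Finset.sum_const_zero, add_zero]
    convert ha.smul (c := (1 - q) ^ (n + 1 - l)) (pow_nonneg (by linarith) _) using 3 with x S
    simp only [leakerWeight]
    split_ifs with hS
    · simp [T0, lk, inn, prod_ite_mem_one S hS]
    · simp
  by_cases hT1 : ∃ j, T = T1 j
  · obtain ⟨j, rfl⟩ := hT1
    have hs : ∑ i, (if T1 j = T1 i then q * (1 - q) ^ (n - l) * b else 0) =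
        q * (1 - q) ^ (n - l) * b := by
      rw [Finset.sum_eq_single j]
      · simp
      · intro i _ hi
        rw [if_neg fun hij => hi (h11 _ _ hij).symm]
      · simp
    simp only [h01, if_false, zero_add, hs]
    refine (hb.smul (c := q * (1 - q) ^ (n - l))
      (mul_nonneg hq0 (pow_nonneg (by linarith) _))).relabel hn (Fin.succAboveEmb j) _
      (fun x S => ?_) (hw _)
    have hj : j ∉ S.map (Fin.succAboveEmb j) := by
      simp
    simp only [leakerWeight, Finset.card_map]
    split_ifs with hS
    · rw [Fin.prod_univ_succAbove _ j, if_neg hj]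
      have : ∀ i, (j.succAbove i ∈ S.map (Fin.succAboveEmb j)) ↔ i ∈ S := fun i => by
        simp
      simp [T1, T0, lk, inn, this, prod_ite_mem_one S hS]
    · simp
  · push Not at hT1
    simp only [hT0, hT1, if_false, Finset.sum_const_zero, add_zero]
    exact achieves_zero _ (hw T)

/-- With `a` and `v` the values for `n + 1` and `n` players and `k = n - l`, the announcement round
gives `(1 - q)^(k+1) * a + (k+1) * q * (1 - q)^k * v ≤ a`. To first order in `q` this says `v ≤ a`.
-/
lemma succN_le_succN_succ {h : ℝ} {l n : ℕ} (hn : 0 < n) (hl : l ≤ n) :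
    succN h l n ≤ succN h l (n + 1) := by
  obtain ⟨k, rfl⟩ := Nat.exists_eq_add_of_le hl
  set a := succN h l (l + k + 1) with ha
  have ha0 : 0 ≤ a := succN_nonneg
  refine le_of_forall_lt_imp_le_of_dense fun v hv => ?_
  have hC : (0 : ℝ) < ((l + k + 1).choose l : ℝ) := by
    exact_mod_cast Nat.choose_pos (by omega)
  have hCC : ((l + k).choose l : ℝ) * (l + k + 1) = ((l + k + 1).choose l : ℝ) * (k + 1) := by
    have := Nat.choose_mul_succ_eq (l + k) l
    rw [show l + k + 1 - l = k + 1 by omega] at this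
    exact_mod_cast this
  have hstep : ∀ q : ℝ, 0 < q → q < 1 → (1 - q) ^ k * v ≤ a := by
    intro q hq0 hq1
    have h1 : (1 - q) ^ (k + 1) * a + (k + 1) * q * (1 - q) ^ k * v ≤ a := by
      -- The supremum `a` need not be attained, so the round continues with value `a - ε`.
      refine le_of_forall_pos_le_add fun ε hε => ?_
      have hu := achieves_of_lt_succN (h := h) (l := l) (n := l + k + 1) (by omega)
        (show a - ε < _ by rw [← ha]; linarith)
      have hv' := achieves_of_lt_succN (h := h) hl hv
      have h2 := hu.announce hn hq0.le hq1.le hv'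
      rw [show l + k + 1 - l = k + 1 by omega, show l + k - l = k by omega] at h2
      have h3 := Achieves.le_succN (h := h) (l := l) (n := l + k + 1) (by omega) (by omega)
        (v := (1 - q) ^ (k + 1) * (a - ε) + (k + 1) * q * (1 - q) ^ k * v) (by
          convert h2 using 1
          push_cast
          linear_combination -(q * (1 - q) ^ k * v * (2 : ℝ) ^ ⌈h⌉₊) * hCC)
      have h4 : (1 - q) ^ (k + 1) ≤ 1 := pow_le_one₀ (by linarith) (by linarith)
      rw [← ha] at h3
      nlinarith
    have h5 : 1 - (k + 1) * q ≤ (1 - q) ^ (k + 1) := by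
      have := one_add_mul_le_pow (a := -q) (by linarith) (k + 1)
      push_cast at this
      rw [← sub_eq_add_neg] at this
      linarith
    have h6 : ((k + 1) * q) * ((1 - q) ^ k * v) ≤ ((k + 1) * q) * a := by nlinarith
    exact le_of_mul_le_mul_left h6 (by positivity)
  have ht : Tendsto (fun q : ℝ => (1 - q) ^ k * v) (𝓝[>] 0) (𝓝 v) := by
    have : Continuous fun q : ℝ => (1 - q) ^ k * v := by fun_prop
    simpa using (this.tendsto 0).mono_left nhdsWithin_le_nhds
  refine le_of_tendsto ht ?_
  filter_upwards [Ioo_mem_nhdsGT (zero_lt_one' ℝ)] with q hq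
  exact hstep q hq.1 hq.2

lemma monotone_succN_add (h : ℝ) (l : ℕ) : Monotone fun n => succN h l (n + (l + 1)) :=
  monotone_nat_of_le_succ fun n => by
    have := succN_le_succN_succ (h := h) (l := l) (n := n + (l + 1)) (by omega) (by omega)
    rwa [show n + (l + 1) + 1 = n + 1 + (l + 1) by ring] at this

lemma tendsto_succN (h : ℝ) (l : ℕ) :
    Tendsto (fun n => succN h l n) atTop (𝓝 (succLim h l)) := by
  have h1 := tendsto_atTop_ciSup (monotone_succN_add h l)
    ⟨1, by rintro _ ⟨n, rfl⟩; exact succN_le_one⟩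
  rw [tendsto_add_atTop_iff_nat (f := fun n => succN h l n)] at h1
  rw [succLim, h1.limUnder_eq]
  exact h1

lemma succN_le_succLim {h : ℝ} {l n : ℕ} (hl : l < n) : succN h l n ≤ succLim h l := by
  have h1 := (tendsto_add_atTop_iff_nat (l + 1)).2 (tendsto_succN h l)
  have h2 := (monotone_succN_add h l).ge_of_tendsto h1 (n - (l + 1))
  rwa [show n - (l + 1) + (l + 1) = n by omega] at h2

lemma succLim_le_one (h : ℝ) (l : ℕ) : succLim h l ≤ 1 :=
  le_of_tendsto' (tendsto_succN h l) fun _ => succN_le_one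

lemma succN_antitone {h h' : ℝ} (hh : h ≤ h') {l n : ℕ} (hn : 0 < n) (hl : l ≤ n) :
    succN h' l n ≤ succN h l n := by
  have hk : ⌈h⌉₊ ≤ ⌈h'⌉₊ := Nat.ceil_mono hh
  have hpow : 2 ^ ⌈h'⌉₊ = 2 ^ (⌈h'⌉₊ - ⌈h⌉₊) * 2 ^ ⌈h⌉₊ := by
    rw [← pow_add, Nat.sub_add_cancel hk]
  refine le_of_forall_lt_imp_le_of_dense fun v hv => ?_
  refine Achieves.le_succN hn hl ?_
  refine Achieves.fix (Y := Fin (2 ^ (⌈h'⌉₊ - ⌈h⌉₊)))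
    ((finCongr hpow).trans finProdFinEquiv.symm) (leakerWeight_nonneg l) ?_
  convert achieves_of_lt_succN hl hv using 1
  have : (2 : ℝ) ^ ⌈h'⌉₊ = 2 ^ (⌈h'⌉₊ - ⌈h⌉₊) * 2 ^ ⌈h⌉₊ := by exact_mod_cast hpow
  rw [this, Fintype.card_fin]
  push_cast
  ring

lemma succLim_antitone (l : ℕ) : Antitone fun h : ℝ => succLim h l := fun h h' hh => by
  refine le_of_tendsto_of_tendsto (tendsto_succN h' l) (tendsto_succN h l) ?_
  filter_upwards [eventually_gt_atTop l] with n hn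
  exact succN_antitone hh (by omega) hn.le

end Monotone

/-! ### The random-set protocol and its tail estimates. -/

section RandomSets

lemma sum_pi_prod {ι κ : Type} [Fintype ι] [DecidableEq ι] [Fintype κ] (f : ι → κ → ℝ) :
    ∑ T : ι → κ, ∏ i, f i (T i) = ∏ i, ∑ a, f i a := by
  rw [Finset.prod_univ_sum, Fintype.piFinset_univ]

/-- The distribution of a bit that is `true` with probability `β`. -/
def bern (β : ℝ) (b : Bool) : ℝ := if b then β else 1 - β

/-- The number of entries `true`. -/
def trueCount {n : ℕ} (r : Fin n → Bool) : ℕ := (Finset.univ.filter fun j => r j = true).card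

/-- The distribution of independent bits that are `true` surely in the positions in `S` and with
probability `β` in the others. -/
def rowWeight {n : ℕ} (β : ℝ) (S : Finset (Fin n)) (r : Fin n → Bool) : ℝ :=
  ∏ j, if j ∈ S then (if r j then 1 else 0) else bern β (r j)

open Classical in
/-- The probability that at least `τ` of these bits are `true`. -/
def tailProb {n : ℕ} (β τ : ℝ) (S : Finset (Fin n)) : ℝ :=
  ∑ r : Fin n → Bool, if τ ≤ trueCount r then rowWeight β S r else 0

variable {n : ℕ} {β : ℝ}

lemma bern_nonneg (h0 : 0 ≤ β) (h1 : β ≤ 1) (b : Bool) : 0 ≤ bern β b := by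
  unfold bern; split_ifs <;> linarith

lemma rowWeight_nonneg (h0 : 0 ≤ β) (h1 : β ≤ 1) (S : Finset (Fin n)) (r : Fin n → Bool) :
    0 ≤ rowWeight β S r :=
  Finset.prod_nonneg fun j _ => by
    have := bern_nonneg h0 h1 (r j)
    split_ifs <;> first | exact this | norm_num

/-- The generating function of the count factors over the players. At `a = 1` it is the total mass;
at `a = exp s` it is the moment generating function for Chernoff's bound. -/
lemma sum_rowWeight_mul_pow (S : Finset (Fin n)) (a : ℝ) :
    ∑ r, rowWeight β S r * a ^ trueCount r = a ^ S.card * (1 + β * (a - 1)) ^ (n - S.card) := by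
  have h1 : ∀ r : Fin n → Bool, rowWeight β S r * a ^ trueCount r =
      ∏ j, (if j ∈ S then (if r j then 1 else 0) else bern β (r j)) * (if r j then a else 1) := by
    intro r
    rw [Finset.prod_mul_distrib, rowWeight, trueCount]
    congr 1
    rw [Finset.prod_ite, Finset.prod_const_one, mul_one, Finset.prod_const]
  simp_rw [h1]
  rw [sum_pi_prod fun j b =>
    (if j ∈ S then (if b then 1 else 0) else bern β b) * (if b then a else 1)]
  have h2 : ∀ j, ∑ b : Bool, (if j ∈ S then (if b then 1 else 0) else bern β b) *
      (if b then a else 1) = if j ∈ S then a else 1 + β * (a - 1) := by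
    intro j
    by_cases hj : j ∈ S <;> simp [hj, bern]
    ring
  simp_rw [h2]
  rw [Finset.prod_ite, Finset.prod_const, Finset.prod_const, ← Finset.compl_filter,
    Finset.filter_univ_mem, Finset.card_compl, Fintype.card_fin]

lemma sum_rowWeight (S : Finset (Fin n)) : ∑ r, rowWeight β S r = 1 := by
  simpa using sum_rowWeight_mul_pow (β := β) S 1

lemma tailProb_nonneg (h0 : 0 ≤ β) (h1 : β ≤ 1) (τ : ℝ) (S : Finset (Fin n)) :
    0 ≤ tailProb β τ S :=
  Finset.sum_nonneg fun r _ => by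
    have := rowWeight_nonneg h0 h1 S r
    split_ifs <;> first | exact this | norm_num

open Classical in
lemma one_sub_tailProb (τ : ℝ) (S : Finset (Fin n)) :
    1 - tailProb β τ S =
      ∑ r : Fin n → Bool, if trueCount r < τ then rowWeight β S r else 0 := by
  rw [← sum_rowWeight (β := β) S, tailProb, ← Finset.sum_sub_distrib]
  refine Finset.sum_congr rfl fun r _ => ?_
  by_cases hr : τ ≤ trueCount r
  · simp [hr, not_lt.2 hr]
  · simp [hr, not_le.1 hr]

lemma tailProb_le_one (h0 : 0 ≤ β) (h1 : β ≤ 1) (τ : ℝ) (S : Finset (Fin n)) :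
    tailProb β τ S ≤ 1 := by
  rw [← sub_nonneg, one_sub_tailProb]
  refine Finset.sum_nonneg fun r _ => ?_
  have := rowWeight_nonneg h0 h1 S r
  split_ifs <;> first | exact this | norm_num

lemma sum_rowWeight_mul_exp_le (h0 : 0 ≤ β) (h1 : β ≤ 1) (S : Finset (Fin n)) (s τ : ℝ) :
    ∑ r, rowWeight β S r * Real.exp (s * (trueCount r - τ)) ≤
      Real.exp (s * (S.card - τ) + (n - S.card) * (β * (Real.exp s - 1))) := by
  have hle : S.card ≤ n := (Finset.card_le_univ S).trans_eq (Fintype.card_fin n)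
  have hr : ∀ r : Fin n → Bool, rowWeight β S r * Real.exp (s * (trueCount r - τ)) =
      Real.exp (-(s * τ)) * (rowWeight β S r * Real.exp s ^ trueCount r) := by
    intro r
    rw [← Real.exp_nat_mul, mul_left_comm, ← Real.exp_add]
    ring_nf
  simp_rw [hr]
  rw [← Finset.mul_sum, sum_rowWeight_mul_pow]
  have hp : (1 + β * (Real.exp s - 1)) ^ (n - S.card) ≤
      Real.exp ((n - S.card) * (β * (Real.exp s - 1))) := by
    rw [← Nat.cast_sub hle, Real.exp_nat_mul]
    refine pow_le_pow_left₀ ?_ (by linarith [Real.add_one_le_exp (β * (Real.exp s - 1))]) _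
    nlinarith [Real.exp_pos s]
  rw [show s * (S.card - τ) + (n - S.card) * (β * (Real.exp s - 1)) =
    -(s * τ) + (S.card * s + (n - S.card) * (β * (Real.exp s - 1))) by ring, Real.exp_add,
    Real.exp_add, Real.exp_nat_mul]
  gcongr

/-- Chernoff's bound for the upper tail. -/
lemma tailProb_empty_le (h0 : 0 ≤ β) (h1 : β ≤ 1) {s : ℝ} (hs : 0 ≤ s) (τ : ℝ) :
    tailProb β τ (∅ : Finset (Fin n)) ≤ Real.exp (-(s * τ) + n * (β * (Real.exp s - 1))) := by
  refine (Finset.sum_le_sum fun r _ => ?_).trans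
    ((sum_rowWeight_mul_exp_le h0 h1 (∅ : Finset (Fin n)) s τ).trans_eq (by simp))
  have hr := rowWeight_nonneg h0 h1 ∅ r
  split_ifs with hτ
  · exact le_mul_of_one_le_right hr (Real.one_le_exp (mul_nonneg hs (by linarith)))
  · exact mul_nonneg hr (Real.exp_pos _).le

/-- Chernoff's bound for the lower tail. -/
lemma one_sub_tailProb_le (h0 : 0 ≤ β) (h1 : β ≤ 1) {s : ℝ} (hs : 0 ≤ s) (τ : ℝ)
    (S : Finset (Fin n)) :
    1 - tailProb β τ S ≤
      Real.exp (s * (τ - S.card) - (n - S.card) * (β * (1 - Real.exp (-s)))) := by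
  rw [one_sub_tailProb]
  refine (Finset.sum_le_sum fun r _ => ?_).trans
    ((sum_rowWeight_mul_exp_le h0 h1 S (-s) τ).trans_eq (by ring_nf))
  have hr := rowWeight_nonneg h0 h1 S r
  split_ifs with hτ
  · exact le_mul_of_one_le_right hr (Real.one_le_exp (by nlinarith))
  · exact mul_nonneg hr (Real.exp_pos _).le

/-- The ratio of the two binomials is `(m + 1 - l) / (m + 1)`. -/
lemma mul_choose_le_choose_pred {m l : ℕ} {q : ℝ} (hq : 0 ≤ q)
    (h : (l : ℝ) ≤ (1 - q) * (m + 1)) : q * ((m + 1).choose l : ℝ) ≤ (m.choose l : ℝ) := by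
  have hl : l ≤ m + 1 := by
    have : (l : ℝ) ≤ (m : ℝ) + 1 := by nlinarith
    exact_mod_cast this
  have h1 : (m.choose l : ℝ) * (m + 1) = ((m + 1).choose l : ℝ) * (m + 1 - l) := by
    have := congrArg (Nat.cast (R := ℝ)) (Nat.choose_mul_succ_eq m l)
    rw [Nat.cast_mul, Nat.cast_mul, Nat.cast_sub hl] at this
    exact_mod_cast this
  have h2 : (0 : ℝ) ≤ ((m + 1).choose l : ℝ) := Nat.cast_nonneg _
  have h3 : (q * ((m + 1).choose l : ℝ)) * (m + 1) ≤ (m.choose l : ℝ) * (m + 1) := by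
    rw [h1]; nlinarith
  exact le_of_mul_le_mul_right h3 (by positivity)

/-- Among the `l`-subsets of a large set, the fraction of those that contain a given element
is small. -/
lemma mul_card_powersetCard_le {l : ℕ} {q : ℝ} (hq : 0 ≤ q) (M : Finset (Fin n))
    (hM : 0 < M.card) (h : (l : ℝ) ≤ (1 - q) * M.card) (i : Fin n) :
    q * ((M.powersetCard l).card : ℝ) ≤ (((M.erase i).powersetCard l).card : ℝ) := by
  obtain ⟨m, hm⟩ : ∃ m, M.card = m + 1 := ⟨M.card - 1, by omega⟩
  rw [Finset.card_powersetCard, Finset.card_powersetCard, hm]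
  have h1 : m ≤ (M.erase i).card := by
    have := Finset.pred_card_le_card_erase (s := M) (a := i)
    omega
  rw [hm] at h
  push_cast at h
  refine (mul_choose_le_choose_pred hq h).trans ?_
  exact_mod_cast Nat.choose_le_choose l h1

variable {X : Type} [Fintype X]

open Classical in
/-- The distribution of a random set of secrets that contains each secret with probability `β`,
except that it surely contains those in `Z`. -/
def setWeight (β : ℝ) (Z : Set X) (A : X → Bool) : ℝ :=
  ∏ y, if y ∈ Z then (if A y then 1 else 0) else bern β (A y)

lemma setWeight_nonneg (h0 : 0 ≤ β) (h1 : β ≤ 1) (Z : Set X) (A : X → Bool) :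
    0 ≤ setWeight β Z A :=
  Finset.prod_nonneg fun j _ => by
    have := bern_nonneg h0 h1 (A j)
    split_ifs <;> first | exact this | norm_num

open Classical in
lemma sum_setWeight (Z : Set X) : ∑ A, setWeight β Z A = 1 := by
  unfold setWeight
  rw [sum_pi_prod fun y b => if y ∈ Z then (if b then 1 else 0) else bern β b]
  refine Finset.prod_eq_one fun y _ => ?_
  by_cases hy : y ∈ Z <;> simp [hy, bern]

lemma setWeight_singleton_mul (x : X) (A : X → Bool) :
    setWeight β {x} A * β = setWeight β ∅ A * if A x then 1 else 0 := by
  classical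
  have hZ : ∀ Z : Set X, (∀ y ≠ x, y ∉ Z) → setWeight β Z A =
      (if x ∈ Z then (if A x then 1 else 0) else bern β (A x)) *
        ∏ y ∈ Finset.univ.erase x, bern β (A y) := fun Z hZ => by
    rw [setWeight, ← Finset.mul_prod_erase _ _ (Finset.mem_univ x)]
    refine congrArg₂ _ rfl ?_
    exact Finset.prod_congr rfl fun y hy => if_neg (hZ y (Finset.ne_of_mem_erase hy))
  rw [hZ {x} fun y hy => hy, hZ ∅ fun y _ => Set.notMem_empty y]
  cases A x <;> simp [bern, mul_comm]

open Classical in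
/-- The likelihood of the messages `T` when the secret is `x` and the leakers are those
in `S`. -/
def setsLikelihood (β : ℝ) (T : Fin n → X → Bool) (x : X) (S : Finset (Fin n)) : ℝ :=
  ∏ j, if j ∈ S then setWeight β {x} (T j) else setWeight β ∅ (T j)

open Classical in
-- The messages form a matrix of bits, independent across players and secrets. Reading it by
-- secrets, only the column of `x` is influenced by the leakers.
lemma setsLikelihood_eq_prod (T : Fin n → X → Bool) (x : X) (S : Finset (Fin n)) :
    setsLikelihood β T x S =
      ∏ y, rowWeight β (if y = x then S else ∅) (fun j => T j y) := by
  unfold setsLikelihood rowWeight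
  rw [Finset.prod_comm]
  refine Finset.prod_congr rfl fun j _ => ?_
  unfold setWeight
  split_ifs with hj
  · refine Finset.prod_congr rfl fun y _ => ?_
    by_cases hy : y = x <;> simp [hy, hj]
  · refine Finset.prod_congr rfl fun y _ => ?_
    by_cases hy : y = x <;> simp [hy, hj]

open Classical in
-- A leaker's message has the innocent likelihood divided by `β` if it contains `x`, and 0
-- otherwise. Hence, for `S` of given size, the posterior is uniform on sets of players naming `x`.
lemma setsLikelihood_eq_ite (hβ : 0 < β) (T : Fin n → X → Bool) (x : X) (S : Finset (Fin n)) :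
    setsLikelihood β T x S = if S ⊆ Finset.univ.filter (fun j => T j x = true) then
      (∏ j, setWeight β ∅ (T j)) / β ^ S.card else 0 := by
  have h1 : setsLikelihood β T x S * β ^ S.card =
      (∏ j, setWeight β ∅ (T j)) * ∏ j, if j ∈ S → T j x = true then 1 else 0 := by
    have h2 : β ^ S.card = ∏ j, if j ∈ S then β else 1 := by
      rw [Finset.prod_ite, Finset.prod_const_one, mul_one, Finset.prod_const,
        Finset.filter_univ_mem]
    rw [h2, setsLikelihood, ← Finset.prod_mul_distrib, ← Finset.prod_mul_distrib]
    refine Finset.prod_congr rfl fun j _ => ?_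
    by_cases hj : j ∈ S
    · simp [hj, setWeight_singleton_mul]
    · simp [hj]
  rw [Finset.prod_ite_zero, Finset.prod_const_one] at h1
  rw [eq_div_of_mul_eq (pow_pos hβ _).ne' h1]
  have h3 : (∀ i ∈ Finset.univ, i ∈ S → T i x = true) ↔
      S ⊆ Finset.univ.filter (fun j => T j x = true) := by
    simp [Finset.subset_iff]
  simp only [h3]
  split_ifs <;> simp

open Classical in
/-- If many messages contain `x`, no player is very likely to be a leaker. -/
lemma mul_sum_setsLikelihood_le (h0 : 0 < β) (h1 : β ≤ 1) {l : ℕ} {q τ : ℝ} (hq : 0 ≤ q)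
    (hq1 : q ≤ 1) (hτ : 0 < τ) (hl : l ≤ (1 - q) * τ) (T : Fin n → X → Bool) (x : X)
    (hT : τ ≤ trueCount fun j => T j x) (i : Fin n) :
    q * ∑ S, setsLikelihood β T x S * leakerWeight l S ≤
      ∑ S, if i ∉ S then setsLikelihood β T x S * leakerWeight l S else 0 := by
  set M := Finset.univ.filter (fun j => T j x = true) with hM
  set c := (∏ j, setWeight β ∅ (T j)) / β ^ l
  have hc : 0 ≤ c := div_nonneg (Finset.prod_nonneg fun j _ => setWeight_nonneg h0.le h1 _ _)
    (pow_nonneg h0.le _)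
  have hW : ∀ S, setsLikelihood β T x S * leakerWeight l S =
      if S ∈ M.powersetCard l then c else 0 := fun S => by
    rw [setsLikelihood_eq_ite h0, ← hM, leakerWeight]
    simp only [Finset.mem_powersetCard]
    by_cases h1 : S ⊆ M <;> by_cases h2 : S.card = l <;> simp [h1, h2, c]
  have hE : ∀ S, (if i ∉ S then setsLikelihood β T x S * leakerWeight l S else 0) =
      if S ∈ (M.erase i).powersetCard l then c else 0 := fun S => by
    rw [hW, ← ite_and]
    simp only [Finset.mem_powersetCard, Finset.subset_erase]
    congr 1
    exact propext (by tauto)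
  simp_rw [hE, hW]
  rw [← Finset.sum_filter, ← Finset.sum_filter, Finset.sum_const, Finset.sum_const,
    Finset.filter_univ_mem, Finset.filter_univ_mem, nsmul_eq_mul, nsmul_eq_mul, ← mul_assoc]
  have hMc : τ ≤ M.card := hT
  refine mul_le_mul_of_nonneg_right (mul_card_powersetCard_le hq M ?_ ?_ i) hc
  · exact_mod_cast hτ.trans_le hMc
  · exact hl.trans (mul_le_mul_of_nonneg_left hMc (by linarith))

open Classical in
lemma sum_setsLikelihood_ite (τ : ℝ) (x : X) (S : Finset (Fin n)) :
    ∑ T : Fin n → X → Bool, (if ∀ y, (if y = x then τ ≤ trueCount (fun j => T j y) else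
        trueCount (fun j => T j y) < τ) then setsLikelihood β T x S else 0) =
      tailProb β τ S * (1 - tailProb β τ (∅ : Finset (Fin n))) ^ (Fintype.card X - 1) := by
  rw [← (Equiv.piComm fun (_ : X) (_ : Fin n) => Bool).sum_comp]
  have h1 : ∀ R : X → Fin n → Bool,
      (if ∀ y, (if y = x then τ ≤ trueCount (R y) else trueCount (R y) < τ) then
        setsLikelihood β (fun j y => R y j) x S else 0) =
      ∏ y, if (if y = x then τ ≤ trueCount (R y) else trueCount (R y) < τ) then
        rowWeight β (if y = x then S else ∅) (R y) else 0 := fun R => by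
    rw [Finset.prod_ite_zero, setsLikelihood_eq_prod]
    simp
  refine (Finset.sum_congr rfl fun R _ => h1 R).trans ?_
  rw [sum_pi_prod fun y r => if (if y = x then τ ≤ trueCount r else trueCount r < τ) then
        rowWeight β (if y = x then S else ∅) r else 0,
    ← Finset.mul_prod_erase _ _ (Finset.mem_univ x)]
  congr 1
  · simp [tailProb]
  · rw [← Finset.card_univ, ← Finset.card_erase_of_mem (Finset.mem_univ x)]
    refine Finset.prod_eq_pow_card fun y hy => ?_
    rw [one_sub_tailProb]
    simp [Finset.ne_of_mem_erase hy]

/-- The protocol in which every player sends a random set of secrets, to which the leakers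
add the true one. -/
lemma achieves_randomSets [Nonempty X] (h0 : 0 < β) (h1 : β ≤ 1) {l : ℕ} {q τ : ℝ} (hq : 0 ≤ q)
    (hq1 : q ≤ 1) (hτ : 0 < τ) (hl : l ≤ (1 - q) * τ) :
    Achieves (n := n) (fun _ : X => leakerWeight l)
      (q * ∑ _x : X, ∑ S : Finset (Fin n), tailProb β τ S *
        (1 - tailProb β τ (∅ : Finset (Fin n))) ^ (Fintype.card X - 1) * leakerWeight l S) := by
  classical
  -- Frank's acceptance rule: `x` is the only secret reaching the threshold.
  let good (T : Fin n → X → Bool) (x : X) : Prop := ∀ y,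
    if y = x then τ ≤ trueCount (fun j => T j y) else trueCount (fun j => T j y) < τ
  have hgood : ∀ T x y, good T x → good T y → x = y := fun T x y hx hy => by
    by_contra hne
    have h2 := hx x
    have h3 := hy x
    rw [if_pos rfl] at h2
    rw [if_neg hne] at h3
    linarith
  have key := achieves_round (n := n) (setWeight β (∅ : Set X)) (fun x => setWeight β {x})
    (setWeight_nonneg h0.le h1 _) (sum_setWeight _) (fun x => setWeight_nonneg h0.le h1 _)
    (fun x => sum_setWeight _) (fun _ => leakerWeight l)
    (fun T => q * ∑ x, if good T x then ∑ S, setsLikelihood β T x S * leakerWeight l S else 0) ?_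
  · convert key using 1
    rw [← Finset.mul_sum]
    refine congrArg (q * ·) (Eq.trans (Finset.sum_congr rfl fun x _ => ?_) Finset.sum_comm)
    have : ∀ T : Fin n → X → Bool,
        (if good T x then ∑ S, setsLikelihood β T x S * leakerWeight l S else 0) =
        ∑ S, (if good T x then setsLikelihood β T x S else 0) * leakerWeight l S := fun T => by
      split_ifs <;> simp
    simp_rw [this]
    refine Eq.trans (Finset.sum_congr rfl fun S _ => ?_) Finset.sum_comm
    rw [← Finset.sum_mul, sum_setsLikelihood_ite]
  intro T
  by_cases hT : ∃ x, good T x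
  · obtain ⟨x, hx⟩ := hT
    refine achieves_silent _ _ x fun i => ?_
    rw [Finset.sum_eq_single x, if_pos hx]
    · have h2 := hx x
      rw [if_pos rfl] at h2
      exact mul_sum_setsLikelihood_le h0 h1 hq hq1 hτ hl T x h2 i
    · intro y _ hy
      rw [if_neg fun h => hy (hgood T y x h hx)]
    · simp
  · push Not at hT
    simp only [hT, if_false, Finset.sum_const_zero, mul_zero]
    refine achieves_zero _ fun x S => mul_nonneg (Finset.prod_nonneg fun j _ => ?_)
      (leakerWeight_nonneg l S)
    split_ifs <;> exact setWeight_nonneg h0.le h1 _ _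

lemma sum_leakerWeight (n l : ℕ) : ∑ S : Finset (Fin n), leakerWeight l S = (n.choose l : ℝ) := by
  simp only [leakerWeight]
  rw [Finset.sum_boole, Finset.univ_filter_card_eq, Finset.card_powersetCard, Finset.card_univ,
    Fintype.card_fin]

lemma le_succN_of_tails {h : ℝ} {l : ℕ} (hn : 0 < n) (hln : l ≤ n) (h0 : 0 < β) (h1 : β ≤ 1)
    {q τ δ ε : ℝ} (hq : 0 ≤ q) (hq1 : q ≤ 1) (hτ : 0 < τ) (hl : l ≤ (1 - q) * τ) (hδ : δ ≤ 1)
    (hlow : ∀ S : Finset (Fin n), S.card = l → 1 - tailProb β τ S ≤ δ)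
    (hup : tailProb β τ (∅ : Finset (Fin n)) ≤ ε) :
    q * ((1 - δ) * (1 - 2 ^ ⌈h⌉₊ * ε)) ≤ succN h l n := by
  refine Achieves.le_succN hn hln ?_
  obtain ⟨π, F, hE⟩ := achieves_randomSets (X := Secret h) (n := n) h0 h1 hq hq1 hτ hl
  refine ⟨π, F, fun E => le_trans ?_ (hE E)⟩
  set t := tailProb β τ (∅ : Finset (Fin n))
  have ht0 : 0 ≤ t := tailProb_nonneg h0.le h1 _ _
  have ht1 : t ≤ 1 := tailProb_le_one h0.le h1 _ _
  -- Bernoulli's inequality serves as the union bound over false secrets.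
  have hpow : 1 - 2 ^ ⌈h⌉₊ * ε ≤ (1 - t) ^ (Fintype.card (Secret h) - 1) := by
    have h2 := one_add_mul_le_pow (a := -t) (by linarith) (Fintype.card (Secret h) - 1)
    rw [← sub_eq_add_neg] at h2
    refine le_trans ?_ h2
    have h3 : ((Fintype.card (Secret h) - 1 : ℕ) : ℝ) ≤ 2 ^ ⌈h⌉₊ := by
      rw [Fintype.card_fin]
      exact_mod_cast Nat.sub_le _ _
    have h4 : ((Fintype.card (Secret h) - 1 : ℕ) : ℝ) * t ≤ 2 ^ ⌈h⌉₊ * ε := by gcongr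
    linarith
  have hsum : ∑ S : Finset (Fin n), (1 - δ) * (1 - 2 ^ ⌈h⌉₊ * ε) * leakerWeight l S ≤
      ∑ S : Finset (Fin n), tailProb β τ S * (1 - t) ^ (Fintype.card (Secret h) - 1) *
        leakerWeight l S := by
    refine Finset.sum_le_sum fun S _ => ?_
    unfold leakerWeight
    split_ifs with hS
    · have h5 := hlow S hS
      have h6 : 0 ≤ (1 - t) ^ (Fintype.card (Secret h) - 1) := pow_nonneg (by linarith) _
      nlinarith
    · simp
  rw [← Finset.mul_sum, sum_leakerWeight] at hsum
  rw [Finset.sum_const, Finset.card_univ, nsmul_eq_mul, mul_assoc,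
    show ((Fintype.card (Secret h) : ℕ) : ℝ) = 2 ^ ⌈h⌉₊ by simp]
  refine mul_le_mul_of_nonneg_left ?_ hq
  rw [mul_left_comm]
  exact mul_le_mul_of_nonneg_left hsum (by positivity)

end RandomSets

/-! ### Choice of parameters and the asymptotic rate. -/

section Rate

/-- The number of bits per leaker in the main theorem. -/
def leakRate (p : ℝ) : ℝ := -Real.logb 2 p / (1 - p) - Real.logb 2 (Real.exp 1)

lemma leakRate_mul_log_two (p : ℝ) :
    leakRate p * Real.log 2 = -Real.log p / (1 - p) - 1 := by
  have h2 : Real.log 2 ≠ 0 := (Real.log_pos one_lt_two).ne'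
  simp only [leakRate, Real.logb, Real.log_exp]
  field_simp

lemma leakRate_pos {p : ℝ} (hp : p ∈ Set.Ioo (0 : ℝ) 1) : 0 < leakRate p := by
  have h2 : 0 < Real.log 2 := Real.log_pos one_lt_two
  have h3 := Real.log_lt_sub_one_of_pos hp.1 hp.2.ne
  have h4 : 0 < leakRate p * Real.log 2 := by
    rw [leakRate_mul_log_two, sub_pos, lt_div_iff₀ (by linarith [hp.2])]
    linarith
  exact pos_of_mul_pos_left h4 h2.le

/-- Up to sign these are slopes of secants of `log` ending at 1, so strict concavity decides. -/
lemma neg_log_div_lt {p q : ℝ} (hq : 0 < q) (hqp : q < p) (hp : p < 1) :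
    -Real.log p / (1 - p) < -Real.log q / (1 - q) := by
  have h := strictConcaveOn_log_Ioi.secant_strict_mono (Set.mem_Ioi.2 zero_lt_one)
    (Set.mem_Ioi.2 hq) (Set.mem_Ioi.2 (hq.trans hqp)) (hqp.trans hp).ne hp.ne hqp
  rw [Real.log_one, sub_zero, sub_zero, ← neg_div_neg_eq, neg_sub, ← neg_div_neg_eq (Real.log q),
    neg_sub] at h
  exact h

lemma two_pow_ceil_le {h p : ℝ} {l : ℕ} (hh : (⌈h⌉₊ : ℝ) ≤ leakRate p * l + 1) :
    (2 : ℝ) ^ ⌈h⌉₊ ≤ 2 * Real.exp ((-Real.log p / (1 - p) - 1) * l) := by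
  have h2 : 0 < Real.log 2 := Real.log_pos one_lt_two
  calc (2 : ℝ) ^ ⌈h⌉₊ = Real.exp (⌈h⌉₊ * Real.log 2) := by
        rw [Real.exp_nat_mul, Real.exp_log two_pos]
    _ ≤ Real.exp (Real.log 2 + (-Real.log p / (1 - p) - 1) * l) := by
        rw [Real.exp_le_exp, ← leakRate_mul_log_two]
        nlinarith
    _ = _ := by rw [Real.exp_add, Real.exp_log two_pos]

lemma exists_le_succLim {p q : ℝ} (hq : 0 < q) (hqp : q < p) (hp : p < 1) :
    ∃ κ₁ > 0, ∃ κ₂ > 0, ∀ (l : ℕ) (h : ℝ), 0 < l → (⌈h⌉₊ : ℝ) ≤ leakRate p * l + 1 →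
      q * ((1 - Real.exp (-(κ₁ * l))) * (1 - 2 * Real.exp (-(κ₂ * l)))) ≤ succLim h l := by
  have hq1 : q < 1 := hqp.trans hp
  have h1q : 0 < 1 - q := by linarith
  obtain ⟨η, hη0, hη⟩ : ∃ η > 0, -Real.log q / (1 - q) = -Real.log p / (1 - p) + η :=
    ⟨_, sub_pos.2 (neg_log_div_lt hq hqp hp), by ring⟩
  set ρ := q / (1 - q) with hρ
  have hρ0 : 0 < ρ := div_pos hq h1q
  -- The three bounds ensure `l < l * D`, `β ≤ 1`, and that removing the `l` leakers from the `l *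
  -- D` players still leaves an expected `ρ * (1 + η / 4) * l` innocents naming the true secret,
  -- against the `ρ * l` needed.
  obtain ⟨D, hD⟩ := exists_nat_ge (max 2 (max (ρ * (1 + η / 2)) (4 / η * (1 + η / 2))))
  have hD2 : (2 : ℝ) ≤ D := (le_max_left _ _).trans hD
  have hDρ : ρ * (1 + η / 2) ≤ D := ((le_max_left _ _).trans (le_max_right _ _)).trans hD
  have hDη : 4 / η * (1 + η / 2) ≤ D := ((le_max_right _ _).trans (le_max_right _ _)).trans hD
  have hD0 : (0 : ℝ) < D := by linarith
  have hD2' : 2 ≤ D := by exact_mod_cast hD2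
  set β := ρ * (1 + η / 2) / D with hβ
  have hβ0 : 0 < β := by positivity
  have hβ1 : β ≤ 1 := (div_le_one hD0).2 hDρ
  have hDβ : D * β = ρ * (1 + η / 2) := by rw [hβ]; field_simp
  have hDβ' : ρ * (1 + η / 4) ≤ (D - 1) * β := by
    have h3 : β ≤ ρ * (η / 4) := by
      rw [hβ, div_le_iff₀ hD0]
      have h4 : 1 + η / 2 ≤ η / 4 * D := by
        have := mul_le_mul_of_nonneg_left hDη (show 0 ≤ η / 4 by positivity)
        refine le_trans (le_of_eq ?_) this
        field_simp
      nlinarith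
    rw [sub_mul, one_mul, hDβ]
    linarith
  refine ⟨ρ * (η / 8) * ((1 + η / 4) / (1 + η / 8) - 1), ?_, η / 2, by positivity,
    fun l h hl hh => ?_⟩
  · have : 1 < (1 + η / 4) / (1 + η / 8) := by
      rw [one_lt_div (by positivity)]
      linarith
    have := sub_pos.2 this
    positivity
  have hl0 : (0 : ℝ) < l := by exact_mod_cast hl
  have hln : l < l * D := by nlinarith
  refine le_trans ?_ (succN_le_succLim hln)
  have hκ : 0 ≤ (1 + η / 4) / (1 + η / 8) - 1 := by
    rw [sub_nonneg, one_le_div (by positivity)]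
    linarith
  have hτl : (l : ℝ) / (1 - q) - l = ρ * l := by rw [hρ]; field_simp; ring
  have key := le_succN_of_tails (h := h) (l := l) (n := l * D) (β := β) (q := q)
    (τ := l / (1 - q))
    (δ := Real.exp (-(ρ * (η / 8) * ((1 + η / 4) / (1 + η / 8) - 1) * l)))
    (ε := Real.exp (-((-Real.log p / (1 - p) - 1 + η / 2) * l))) (by omega) hln.le hβ0 hβ1
    hq.le hq1.le (by positivity) (by field_simp; rfl)
    (by rw [Real.exp_le_one_iff, neg_nonpos]; positivity) ?_ ?_
  · refine le_trans ?_ key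
    have h5 : (2 : ℝ) ^ ⌈h⌉₊ * Real.exp (-((-Real.log p / (1 - p) - 1 + η / 2) * l)) ≤
        2 * Real.exp (-(η / 2 * l)) := by
      refine (mul_le_mul_of_nonneg_right (two_pow_ceil_le hh) (Real.exp_pos _).le).trans_eq ?_
      rw [mul_assoc, ← Real.exp_add]
      ring_nf
    have h6 : Real.exp (-(ρ * (η / 8) * ((1 + η / 4) / (1 + η / 8) - 1) * l)) ≤ 1 := by
      rw [Real.exp_le_one_iff, neg_nonpos]; positivity
    refine mul_le_mul_of_nonneg_left (mul_le_mul_of_nonneg_left ?_ ?_) hq.le <;> linarith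
  -- Lower tail for the true secret: the tilt `η / 8` is below the surplus `η / 4`, so `1 - exp (-s)
  -- ≥ s / (1 + s)` leaves a negative exponent.
  · intro S hS
    refine (one_sub_tailProb_le hβ0.le hβ1 (s := η / 8) (by positivity) _ S).trans ?_
    rw [Real.exp_le_exp, hS, hτl]
    have h7 : η / 8 / (1 + η / 8) ≤ 1 - Real.exp (-(η / 8)) := by
      have h8 : Real.exp (-(η / 8)) ≤ 1 / (1 + η / 8) := by
        rw [Real.exp_neg, inv_eq_one_div]
        exact one_div_le_one_div_of_le (by positivity) (by linarith [Real.add_one_le_exp (η / 8)])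
      have h9 : η / 8 / (1 + η / 8) = 1 - 1 / (1 + η / 8) := by field_simp; ring
      linarith
    have h10 : ρ * (1 + η / 4) * (η / 8 / (1 + η / 8)) ≤
        (D - 1) * β * (1 - Real.exp (-(η / 8))) :=
      mul_le_mul hDβ' h7 (by positivity) (le_trans (by positivity) hDβ')
    have h11 := mul_le_mul_of_nonneg_right h10 hl0.le
    push_cast
    calc _ = η / 8 * ρ * l - (D - 1) * β * (1 - Real.exp (-(η / 8))) * l := by ring
      _ ≤ η / 8 * ρ * l - ρ * (1 + η / 4) * (η / 8 / (1 + η / 8)) * l := by linarith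
      _ = _ := by ring
  -- Upper tail for a false secret: `1 / q` is the ratio of the threshold `l / (1 - q)` to `ρ * l`,
  -- so `-log q` is the optimal Poisson tilt for mean `ρ * l`.
  · refine (tailProb_empty_le hβ0.le hβ1 (s := -Real.log q)
      (neg_nonneg.2 (Real.log_nonpos hq.le hq1.le)) _).trans_eq ?_
    rw [Real.exp_neg, Real.exp_log hq]
    congr 1
    push_cast
    have h12 : (l : ℝ) * D * (β * (q⁻¹ - 1)) = (1 + η / 2) * l := by
      rw [show (l : ℝ) * D * (β * (q⁻¹ - 1)) = D * β * (q⁻¹ - 1) * l by ring, hDβ, hρ]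
      field_simp
    rw [h12, show -(-Real.log q * (l / (1 - q))) = -(-Real.log q / (1 - q)) * l by ring, hη]
    ring

lemma eventually_le_succLim {p y : ℝ} (hp : p ∈ Set.Ioo (0 : ℝ) 1) (hy : y < p) :
    ∀ᶠ l : ℕ in atTop, y ≤ succLim ((⌈leakRate p * (l : ℝ)⌉ : ℤ) : ℝ) l := by
  obtain ⟨q, hyq, hqp⟩ := exists_between (max_lt hy hp.1)
  have hq : 0 < q := (le_max_right _ _).trans_lt hyq
  obtain ⟨κ₁, hκ₁, κ₂, hκ₂, hle⟩ := exists_le_succLim hq hqp hp.2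
  have hexp : ∀ κ : ℝ, 0 < κ → Tendsto (fun l : ℕ => Real.exp (-(κ * l))) atTop (𝓝 0) :=
    fun κ hκ => Real.tendsto_exp_neg_atTop_nhds_zero.comp
      (tendsto_natCast_atTop_atTop.const_mul_atTop hκ)
  have ht : Tendsto (fun l : ℕ =>
      q * ((1 - Real.exp (-(κ₁ * l))) * (1 - 2 * Real.exp (-(κ₂ * l))))) atTop (𝓝 q) := by
    simpa using (((hexp κ₁ hκ₁).const_sub 1).mul
      (((hexp κ₂ hκ₂).const_mul 2).const_sub 1)).const_mul q
  filter_upwards [ht.eventually (lt_mem_nhds ((le_max_left _ _).trans_lt hyq)),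
    eventually_gt_atTop 0] with l h1 h2
  refine h1.le.trans (hle l _ h2 ?_)
  rw [Nat.ceil_intCast]
  have h3 : 0 ≤ ⌈leakRate p * (l : ℝ)⌉ := Int.ceil_nonneg
    (mul_nonneg (leakRate_pos hp).le (Nat.cast_nonneg l))
  have h4 : ((⌈leakRate p * (l : ℝ)⌉.toNat : ℕ) : ℝ) = ((⌈leakRate p * (l : ℝ)⌉ : ℤ) : ℝ) := by
    exact_mod_cast Int.toNat_of_nonneg h3
  rw [h4]
  exact (Int.ceil_lt_add_one _).le

end Rate

end Cryptogenography
end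

theorem mainTheorem6 :
    -- the limit defining `Succ(h, l)` exists
    (∀ (h : ℝ) (l : ℕ), 0 ≤ h →
      Tendsto (fun n : ℕ => Cryptogenography.succN h l n) atTop
        (𝓝 (Cryptogenography.succLim h l))) ∧
    -- `Succ(h, l)` is non-increasing in `h`
    (∀ l : ℕ, AntitoneOn (fun h : ℝ => Cryptogenography.succLim h l) (Set.Ici 0)) ∧
    -- the lower bound
    (∀ p : ℝ, p ∈ Set.Ioo (0 : ℝ) 1 →
      p ≤ liminf
        (fun l : ℕ => Cryptogenography.succLim
          ((⌈(-Real.logb 2 p / (1 - p) - Real.logb 2 (Real.exp 1)) * (l : ℝ)⌉ : ℤ) : ℝ) l)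
        atTop) ∧
    -- the case `h = o(l)`
    (∀ h : ℕ → ℝ, (∀ l, 0 ≤ h l) → Asymptotics.IsLittleO atTop h (fun l : ℕ => (l : ℝ)) →
      Tendsto (fun l : ℕ => Cryptogenography.succLim (h l) l) atTop (𝓝 1)) := by
  refine ⟨fun h l _ => Cryptogenography.tendsto_succN h l,
    fun l => (Cryptogenography.succLim_antitone l).antitoneOn _, fun p hp => ?_,
    fun h _ ho => ?_⟩
  · refine le_of_forall_lt_imp_le_of_dense fun y hy => ?_
    refine le_liminf_of_le ?_ (Cryptogenography.eventually_le_succLim hp hy)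
    exact isCoboundedUnder_ge_of_le atTop fun l => Cryptogenography.succLim_le_one _ l
  · refine tendsto_order.2 ⟨fun a ha => ?_, fun a ha => Eventually.of_forall fun l =>
      (Cryptogenography.succLim_le_one _ l).trans_lt ha⟩
    -- For `p` close to 1 the rate is still positive, so `h l = o(l)` eventually lies below it and
    -- monotonicity in `h` applies.
    obtain ⟨y, hy, hy1⟩ := exists_between (max_lt ha zero_lt_one)
    obtain ⟨p, hyp, hp1⟩ := exists_between hy1
    have hp : p ∈ Set.Ioo (0 : ℝ) 1 := ⟨((le_max_right _ _).trans_lt hy).trans hyp, hp1⟩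
    filter_upwards [Cryptogenography.eventually_le_succLim hp hyp,
      ho.bound (Cryptogenography.leakRate_pos hp)] with l h1 h2
    refine ((le_max_left _ _).trans_lt hy).trans_le (h1.trans ?_)
    refine Cryptogenography.succLim_antitone l ?_
    rw [Real.norm_natCast] at h2
    exact (le_abs_self _).trans (h2.trans (Int.le_ceil _))
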